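/- Let $\kappa$ be a strongly compact cardinal, i.e. $\kappa$ is uncountable and every (proper) $\kappa$-complete filter on any set extends to a $\kappa$-complete ultrafilter. Let $K=(K,\prec)$ be an abstract elementary class in a language $L$ with Löwenheim–Skolem number $LS(K)$ (the least $\lambda\ge |L|+\aleph_0$ such that for all $M\in K$ and $A\subseteq |M|$ there is $N\prec M$ with $A\subseteq |N|$ and $\|N\|\le |A|+\lambda$). A $K$-embedding $f:M\to N$ is an isomorphism of $M$ onto some $f(M)\prec N$. Assume that $K$ is essentially below $\kappa$: either (a) $LS(K)<\kappa$, or (b) $K=(\mathrm{Mod}\,T,\prec_{\mathcal F})$ for an $L_{\kappa,\omega}$-theory $T$ and a set $\mathcal F$ of $L_{\kappa,\omega}$-formulas (e.g. a fragment of $L_{\kappa,\omega}$ containing $T$), where $M\prec_{\mathcal F}N$ means that $M$ is a substructure of $N$ and every formula of $\mathcal F$ has the same truth value in $M$ and in $N$ at every tuple of $M$. Assume also that $K$ has a monster model, in the following sense: for every cardinal $\mu$ there is $\mathfrak C\in K$ with $\mathrm{cf}(\|\mathfrak C\|)>\mu$ such that every $N\in K$ with $\|N\|\le\mu$ has a $K$-embedding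 into $\mathfrak C$, and such that whenever $M\prec\mathfrak C$, $M\prec N$ and $\|N\|\le\mu$, there is a $K$-embedding $N\to\mathfrak C$ that fixes $M$ pointwise. For a set $I$ and $M\in K$, let $S^I(M)$ be the set of Galois types $\mathrm{tp}(\langle a_i:i\in I\rangle/M,N)$, with $M\prec N\in K$ and all $a_i\in|N|$. Here $\mathrm{tp}(\langle a_i\rangle/M,N)$ is the class of $(\langle a_i\rangle,M,N)$ under the transitive closure of the relation that holds between $(\langle a_i\rangle,M,N)$ and $(\langle b_i\rangle,M,N')$ when there are $N^*\in K$ and $K$-embeddings $f:N\to N^*$, $g:N'\to N^*$ that agree on $M$ and satisfy $f(a_i)=g(b_i)$ for all $i\in I$. For $p=\mathrm{tp}(\langle a_i:i\in I\rangle/M,N)$, $I_0\subseteq I$ and $M_0\prec M$, put $p^{I_0}=\mathrm{tp}(\langle a_i:i\in I_0\rangle/M,N)$ and $p\restriction M_0=\mathrm{tp}(\langle a_i:i\in I\rangle/M_0,N)$. Then: 1. For every set $I$, every $M\in K$ and all $p,q\in S^I(M)$: if $p^{I_0}\restriction M_0=q^{I_0}\restriction M_0$ for all $I_0\subseteq I$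 with $|I_0|<\kappa$ and all $M_0\prec M$ with $\|M_0\|<\kappa+LS(K)^+$, then $p=q$. 2. $K$ is fully $<(\kappa+LS(K)^+)$ tame: for every set $I$, every $M\in K$ with $\|M\|\ge\kappa+LS(K)^+$ and all $p\ne q$ in $S^I(M)$ there is $M_0\prec M$ with $\|M_0\|<\kappa+LS(K)^+$ and $p\restriction M_0\neq q\restriction M_0$. 3. $K$ is fully $<\kappa$ type short: for every $M\in K$, every set $I$ with $|I|\ge\kappa$ and all $p\ne q$ in $S^I(M)$ there is $I_0\subseteq I$ with $|I_0|<\kappa$ and $p^{I_0}\ne q^{I_0}$. -/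

import Mathlib

open Cardinal FirstOrder FirstOrder.Language

universe u

/-- For substructures `S` and `T` of `N`, the elements of `T` that lie in `S`, as a substructure of
`T`.  It is used when `S ≤ T`, in which case it is `S` itself, seen inside `T`. -/
def FirstOrder.Language.Substructure.inside {L : FirstOrder.Language.{u, u}} {N : Type u} [L.Structure N]
    (S T : L.Substructure N) : L.Substructure T :=
  S.comap T.subtype.toHom

/-- An abstract elementary class `(K, ≺)` in the language `L`.  Since `M ≺ N` forces `M` to be a
substructure of `N`, the relation `≺` is given by the substructures `S` of each `N` such that
`S ≺ N`.  All models have their universe in `Type u`, which plays the role of the class of sets. -/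
structure AEC (L : FirstOrder.Language.{u, u}) where
  /-- `M ∈ K` -/
  Mem : ∀ (M : Type u) [L.Structure M], Prop
  /-- `S ≺ N` -/
  Strong : ∀ (N : Type u) [L.Structure N], L.Substructure N → Prop
  mem_left : ∀ (N : Type u) [L.Structure N] (S : L.Substructure N), Strong N S → Mem S
  mem_right : ∀ (N : Type u) [L.Structure N] (S : L.Substructure N), Strong N S → Mem N
  refl : ∀ (N : Type u) [L.Structure N], Mem N → Strong N ⊤
  trans : ∀ (N : Type u) [L.Structure N] (S T : L.Substructure N), S ≤ T →
    Strong T (S.inside T) → Strong N T → Strong N S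
  mem_iso : ∀ (N N' : Type u) [L.Structure N] [L.Structure N'], (N ≃[L] N') → Mem N → Mem N'
  strong_iso : ∀ (N N' : Type u) [L.Structure N] [L.Structure N'] (f : N ≃[L] N')
    (S : L.Substructure N), Strong N S → Strong N' (S.map f.toHom)
  coherence : ∀ (N : Type u) [L.Structure N] (S T : L.Substructure N), S ≤ T →
    Strong N S → Strong N T → Strong T (S.inside T)
  /-- The union `N` of a `≺`-increasing continuous chain `S i`, `i < α`, of members of `K` is in
  `K`, and `S i ≺ N` for all `i < α`. -/
  chain_union : ∀ (N : Type u) [L.Structure N] (α : Ordinal.{u}) (S : Ordinal.{u} → L.Substructure N),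
    α ≠ 0 → (∀ i < α, Mem (S i)) →
    (∀ i j, i ≤ j → j < α → S i ≤ S j ∧ Strong (S j) ((S i).inside (S j))) →
    (∀ δ < α, Order.IsSuccLimit δ → (S δ : Set N) = ⋃ i < δ, (S i : Set N)) →
    (⋃ i < α, (S i : Set N)) = Set.univ →
    Mem N ∧ ∀ i < α, Strong N (S i)
  /-- If `S i`, `i < α`, is a `≺`-increasing continuous chain of members of `K` and `S i ≺ N` for
  all `i < α`, then the union of the chain is `≺ N`. -/
  chain_bound : ∀ (N : Type u) [L.Structure N] (α : Ordinal.{u}) (S : Ordinal.{u} → L.Substructure N)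
    (U : L.Substructure N),
    α ≠ 0 → (∀ i < α, Mem (S i)) →
    (∀ i j, i ≤ j → j < α → S i ≤ S j ∧ Strong (S j) ((S i).inside (S j))) →
    (∀ δ < α, Order.IsSuccLimit δ → (S δ : Set N) = ⋃ i < δ, (S i : Set N)) →
    (U : Set N) = (⋃ i < α, (S i : Set N)) →
    (∀ i < α, Strong N (S i)) → Strong N U
  exists_LS : ∃ c : Cardinal.{u}, L.card + ℵ₀ ≤ c ∧
    ∀ (M : Type u) [L.Structure M], Mem M → ∀ A : Set M,
      ∃ S : L.Substructure M, Strong M S ∧ A ⊆ S ∧ #S ≤ #A + c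

namespace AEC

variable {L : FirstOrder.Language.{u, u}} (K : AEC L)

/-- The Löwenheim–Skolem number of `K`. -/
noncomputable def LS : Cardinal.{u} :=
  sInf {c : Cardinal.{u} | L.card + ℵ₀ ≤ c ∧
    ∀ (M : Type u) [L.Structure M], K.Mem M → ∀ A : Set M,
      ∃ S : L.Substructure M, K.Strong M S ∧ A ⊆ S ∧ #S ≤ #A + c}

/-- `f` is a `K`-embedding: its image is `≺ N`. -/
def IsEmb {M N : Type u} [L.Structure M] [L.Structure N] (f : M ↪[L] N) : Prop :=
  K.Strong N f.toHom.range

section helpers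

variable {K} {M N P : Type u} [L.Structure M] [L.Structure N] [L.Structure P]

theorem isEmb_subtype {S : L.Substructure M} (h : K.Strong M S) : K.IsEmb S.subtype := by
  have : S.subtype.toHom.range = S := Substructure.range_subtype S
  unfold IsEmb
  rw [this]
  exact h

theorem IsEmb.comp {g : N ↪[L] P} {f : M ↪[L] N} (hg : K.IsEmb g) (hf : K.IsEmb f) :
    K.IsEmb (g.comp f) := by
  have hle : (g.comp f).toHom.range ≤ g.toHom.range := by
    rintro _ ⟨x, rfl⟩
    exact ⟨f x, rfl⟩
  refine K.trans P _ _ hle ?_ hg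
  have h := K.strong_iso N g.toHom.range g.equivRange _ hf
  convert h using 1
  ext ⟨y, hy⟩
  simp only [Substructure.inside, Substructure.mem_comap, Substructure.mem_map, Hom.mem_range]
  constructor
  · rintro ⟨x, hx⟩
    exact ⟨f x, ⟨x, rfl⟩, Subtype.ext hx⟩
  · rintro ⟨_, ⟨x, rfl⟩, hx⟩
    exact ⟨x, congrArg Subtype.val hx⟩

end helpers

/-! ### Galois types of arbitrary length -/

/-- A pretype of length `I` over `M`: a triple `(⟨a i : i ∈ I⟩, M, N)` with `M ≺ N` and all `a i` in
`N`, where the inclusion of `M` in `N` is written as a `K`-embedding. -/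
structure Pretype (I M : Type u) [L.Structure M] where
  N : Type u
  [str : L.Structure N]
  incl : M ↪[L] N
  isEmb : K.IsEmb incl
  a : I → N

attribute [instance] Pretype.str

variable {K}

/-- The atomic relation between pretypes over the same `M`. -/
def Pretype.AT {I M : Type u} [L.Structure M] (p q : K.Pretype I M) : Prop :=
  ∃ (N' : Type u) (_ : L.Structure N') (f : p.N ↪[L] N') (g : q.N ↪[L] N'),
    K.IsEmb f ∧ K.IsEmb g ∧ (∀ m : M, f (p.incl m) = g (q.incl m)) ∧ ∀ i : I, f (p.a i) = g (q.a i)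

variable (K)

/-- The set `S^I(M)` of Galois types of length `I` over `M`: pretypes modulo the equivalence
relation generated by `AT`.  As `AT` is reflexive and symmetric, this is its transitive closure. -/
def GType (I M : Type u) [L.Structure M] : Type (u + 1) :=
  Quot (Pretype.AT (K := K) (I := I) (M := M))

variable {K}

/-- The restriction of a pretype to a smaller domain `M₀ ≺ M`. -/
def Pretype.restrict {I M : Type u} [L.Structure M] (p : K.Pretype I M) (M₀ : L.Substructure M)
    (h : K.Strong M M₀) : K.Pretype I M₀ where
  N := p.N
  incl := p.incl.comp M₀.subtype
  isEmb := p.isEmb.comp (isEmb_subtype h)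
  a := p.a

/-- The restriction of a pretype to a smaller index set `I₀ ⊆ I`. -/
def Pretype.restrictIndex {I M : Type u} [L.Structure M] (p : K.Pretype I M) (I₀ : Set I) :
    K.Pretype I₀ M where
  N := p.N
  incl := p.incl
  isEmb := p.isEmb
  a := fun i => p.a i

/-- `p ↾ M₀` -/
def GType.restrict {I M : Type u} [L.Structure M] (p : K.GType I M) (M₀ : L.Substructure M)
    (h : K.Strong M M₀) : K.GType I M₀ :=
  Quot.map (fun x : K.Pretype I M => x.restrict M₀ h)
    (fun _ _ ⟨N', s, f, g, hf, hg, hM, ha⟩ => ⟨N', s, f, g, hf, hg, fun m => hM m, ha⟩) p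

/-- `p ^ I₀` -/
def GType.restrictIndex {I M : Type u} [L.Structure M] (p : K.GType I M) (I₀ : Set I) :
    K.GType I₀ M :=
  Quot.map (fun x : K.Pretype I M => x.restrictIndex I₀)
    (fun _ _ ⟨N', s, f, g, hf, hg, hM, ha⟩ => ⟨N', s, f, g, hf, hg, hM, fun i => ha i⟩) p

variable (K)

/-! ### Tameness and type shortness -/

/-- `K` is `(< χ, μ)` tame for `I` length types. -/
def TameFor (χ μ : Cardinal.{u}) (I : Type u) : Prop :=
  ∀ (M : Type u) [L.Structure M], K.Mem M → #M = μ → ∀ p q : K.GType I M, p ≠ q →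
    ∃ (M₀ : L.Substructure M) (h : K.Strong M M₀), #M₀ < χ ∧ p.restrict M₀ h ≠ q.restrict M₀ h

/-- `K` is fully `< χ` tame. -/
def FullyTame (χ : Cardinal.{u}) : Prop :=
  ∀ I : Type u, ∀ μ, χ ≤ μ → K.TameFor χ μ I

/-- `K` is `(< χ, ν)` type short over `μ` sized models. -/
def TypeShortOver (χ ν μ : Cardinal.{u}) : Prop :=
  ∀ (M : Type u) [L.Structure M], K.Mem M → #M = μ → ∀ I : Type u, #I = ν →
    ∀ p q : K.GType I M, p ≠ q →
      ∃ I₀ : Set I, #I₀ < χ ∧ p.restrictIndex I₀ ≠ q.restrictIndex I₀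

/-- `K` is fully `< χ` type short. -/
def FullyTypeShort (χ : Cardinal.{u}) : Prop :=
  ∀ μ ν, χ ≤ ν → K.TypeShortOver χ ν μ

/-! ### Monster models -/

/-- `C` is a monster model with respect to models of size at most `c`: it is a member of `K` whose
size has cofinality above `c` (so it is larger than `c`), and it is universal and model homogeneous
for the members of `K` of size at most `c`. -/
structure IsMonster (c : Cardinal.{u}) (C : Type u) [L.Structure C] : Prop where
  mem : K.Mem C
  lt_cof : c < (#C).ord.cof
  universal : ∀ (N : Type u) [L.Structure N], K.Mem N → #N ≤ c → ∃ f : N ↪[L] C, K.IsEmb f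
  homogeneous : ∀ (M : L.Substructure C), K.Strong C M →
    ∀ (N : Type u) [L.Structure N] (j : M ↪[L] N), K.IsEmb j → #N ≤ c →
      ∃ f : N ↪[L] C, K.IsEmb f ∧ ∀ m : M, f (j m) = m

/-- `K` has a monster model: as the monster has to be universal and model homogeneous for whatever
models are considered, there is one for every bound on their size. -/
def HasMonsterModel : Prop :=
  ∀ c : Cardinal.{u}, ∃ (C : Type u) (_ : L.Structure C), K.IsMonster c C

end AEC

/-! ### The logic `L_{κ,ω}` -/

/-- `L_{κ,ω}`-formulas with free variables among `x_0, …, x_{n-1}`: conjunctions of fewer than `κ`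
formulas and finite strings of quantifiers.  Disjunctions and existential quantifiers are obtained
with negations. -/
inductive InfFormula (L : FirstOrder.Language.{u, u}) (κ : Cardinal.{u}) : ℕ → Type (u + 1)
  | equal {n : ℕ} (t s : L.Term (Fin n)) : InfFormula L κ n
  | rel {n k : ℕ} (R : L.Relations k) (ts : Fin k → L.Term (Fin n)) : InfFormula L κ n
  | neg {n : ℕ} (φ : InfFormula L κ n) : InfFormula L κ n
  | conj {n : ℕ} (ι : Type u) (h : #ι < κ) (φ : ι → InfFormula L κ n) : InfFormula L κ n
  | all {n : ℕ} (φ : InfFormula L κ (n + 1)) : InfFormula L κ n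

/-- Satisfaction of an `L_{κ,ω}`-formula in a structure. -/
def InfFormula.Realize {L : FirstOrder.Language.{u, u}} {κ : Cardinal.{u}} {M : Type u} [L.Structure M] :
    ∀ {n : ℕ}, InfFormula L κ n → (Fin n → M) → Prop
  | _, .equal t s, v => t.realize v = s.realize v
  | _, .rel R ts, v => Structure.RelMap R fun i => (ts i).realize v
  | _, .neg φ, v => ¬ φ.Realize v
  | _, .conj _ _ φ, v => ∀ i, (φ i).Realize v
  | _, .all φ, v => ∀ x : M, φ.Realize (Fin.snoc v x : Fin (_ + 1) → M)

namespace AEC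

variable {L : FirstOrder.Language.{u, u}} (K : AEC L)

/-- `K = (Mod T, ≺_F)` for some `L_{κ,ω}`-theory `T` and some set `F` of `L_{κ,ω}`-formulas, where
`S ≺_F N` means that `S` is a substructure of `N` and all formulas of `F` have the same meaning in
`S` and in `N`.  Fragments of `L_{κ,ω}` that contain `T` are a special case of `F`. -/
def IsModClass (κ : Cardinal.{u}) : Prop :=
  ∃ (T : Set (InfFormula L κ 0)) (F : ∀ n : ℕ, Set (InfFormula L κ n)),
    (∀ (M : Type u) [L.Structure M],
      K.Mem M ↔ Nonempty M ∧ ∀ φ ∈ T, φ.Realize (Fin.elim0 : Fin 0 → M)) ∧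
    ∀ (N : Type u) [L.Structure N] (S : L.Substructure N),
      K.Strong N S ↔ K.Mem S ∧ K.Mem N ∧ ∀ (n : ℕ), ∀ φ ∈ F n, ∀ v : Fin n → S,
        φ.Realize v ↔ φ.Realize (fun i => (v i : N))

/-- `K` is essentially below `κ`. -/
def EssentiallyBelow (κ : Cardinal.{u}) : Prop :=
  K.LS < κ ∨ K.IsModClass κ

end AEC

/-- `κ` is strongly compact: it is uncountable, and every proper `κ`-complete filter on any set
extends to a `κ`-complete ultrafilter. -/
def IsStronglyCompact (κ : Cardinal.{u}) : Prop :=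
  ℵ₀ < κ ∧ ∀ (α : Type u) (F : Filter α), F.NeBot → CardinalInterFilter F κ →
    ∃ U : Ultrafilter α, (U : Filter α) ≤ F ∧ CardinalInterFilter (U : Filter α) κ

/-! Let `p`, `q` have equal small restrictions. The monster model yields amalgamation, so
`Pretype.AT` is already transitive (`Pretype.at_equivalence`), and equality at a small pair X = (I₀,
M₀) is witnessed by one model N_X with K-embeddings of all of `p.N` and all of `q.N` into it,
agreeing on X. Strong compactness gives a κ-complete ultrafilter on the set of these X that is fine:
each i ∈ I and each m ∈ M belongs to almost all X (`IsStronglyCompact.exists_fine`). In the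
ultraproduct of the N_X the two lifted maps then agree on all of M and I, so p = q. Tameness and
type shortness are contrapositives.

It remains to see that the lifted maps are K-embeddings (`ClosedUnderUltraproduct`). For a class
axiomatized in L_{κ,ω} this is Łoś's theorem. If LS(K) < κ, an ultraproduct of submodels of size ≤
LS(K) is isomorphic to almost all of its factors, because fewer than κ conditions describe it; so ≺
transfers between such ultraproducts. They form a directed system covering the whole ultraproduct,
and an AEC is closed under directed unions (`directed_union`). -/

namespace FirstOrder.Language.Substructure

variable {L : FirstOrder.Language.{u, u}} {N : Type u} [L.Structure N]

theorem mem_inside {S T : L.Substructure N} {x : T} : x ∈ S.inside T ↔ (x : N) ∈ S :=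
  Iff.rfl

/-- A substructure contained in `T` is isomorphic to the copy of it inside `T`. -/
def insideEquiv {S T : L.Substructure N} (h : S ≤ T) : S ≃[L] S.inside T where
  toFun x := ⟨⟨x, h x.2⟩, x.2⟩
  invFun x := ⟨x.1.1, x.2⟩
  left_inv _ := rfl
  right_inv _ := rfl
  map_fun' _ _ := rfl
  map_rel' _ _ := Iff.rfl

end FirstOrder.Language.Substructure

/-! ### The relation ≺ between substructures of one ambient structure -/

namespace AEC

variable {L : FirstOrder.Language.{u, u}} (K : AEC L)

theorem strong_of_equiv {N N' : Type u} [L.Structure N] [L.Structure N'] (e : N ≃[L] N')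
    {S : L.Substructure N} {S' : L.Substructure N'} (h : ∀ x, x ∈ S ↔ e x ∈ S')
    (hS : K.Strong N S) : K.Strong N' S' := by
  have := K.strong_iso N N' e S hS
  convert this using 1
  ext y
  obtain ⟨x, rfl⟩ := e.surjective y
  rw [← h x, Substructure.mem_map]
  exact ⟨fun hx => ⟨x, hx, rfl⟩, fun ⟨z, hz, hzx⟩ => e.injective hzx ▸ hz⟩

/-- `S ≺ T`, for substructures `S` and `T` of the same structure. -/
def StrongSub {N : Type u} [L.Structure N] (S T : L.Substructure N) : Prop :=
  S ≤ T ∧ K.Strong T (S.inside T)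

section StrongSub

variable {K} {N : Type u} [L.Structure N] {S T U : L.Substructure N}

theorem strong_inside_inside_iff (hTU : T ≤ U) :
    K.Strong (T.inside U) ((S.inside U).inside (T.inside U)) ↔ K.Strong T (S.inside T) :=
  ⟨K.strong_of_equiv (Substructure.insideEquiv hTU).symm fun _ => Iff.rfl,
    K.strong_of_equiv (Substructure.insideEquiv hTU) fun _ => Iff.rfl⟩

theorem StrongSub.refl (h : K.Mem S) : K.StrongSub S S := by
  refine ⟨le_rfl, ?_⟩
  convert K.refl S h
  ext x
  exact ⟨fun _ => trivial, fun _ => x.2⟩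

theorem StrongSub.trans (h : K.StrongSub S T) (h' : K.StrongSub T U) : K.StrongSub S U :=
  ⟨h.1.trans h'.1, K.trans U _ (T.inside U) (fun _ hx => h.1 hx)
    ((strong_inside_inside_iff h'.1).2 h.2) h'.2⟩

theorem StrongSub.mem_right (h : K.StrongSub S T) : K.Mem T := K.mem_right _ _ h.2

theorem StrongSub.mem_left (h : K.StrongSub S T) : K.Mem S :=
  K.mem_iso _ _ (Substructure.insideEquiv h.1).symm (K.mem_left _ _ h.2)

theorem StrongSub.coherence (h : K.StrongSub S U) (h' : K.StrongSub T U) (hST : S ≤ T) :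
    K.StrongSub S T :=
  ⟨hST, (strong_inside_inside_iff h'.1).1
    (K.coherence U (S.inside U) (T.inside U) (fun _ hx => hST hx) h.2 h'.2)⟩

theorem strongSub_top_iff : K.StrongSub S ⊤ ↔ K.Strong N S :=
  ⟨fun h => K.strong_of_equiv Substructure.topEquiv (fun _ => Iff.rfl) h.2,
    fun h => ⟨le_top, K.strong_of_equiv Substructure.topEquiv.symm (fun _ => Iff.rfl) h⟩⟩

theorem StrongSub.chain_union {α : Ordinal.{u}} {S : Ordinal.{u} → L.Substructure N}
    (h0 : α ≠ 0) (hS : ∀ i j, i ≤ j → j < α → K.StrongSub (S i) (S j))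
    (hlim : ∀ δ < α, Order.IsSuccLimit δ → (S δ : Set N) = ⋃ i < δ, (S i : Set N))
    (hU : (U : Set N) = ⋃ i < α, (S i : Set N)) :
    K.Mem U ∧ ∀ i < α, K.StrongSub (S i) U := by
  have hle : ∀ i < α, S i ≤ U := fun i hi x hx => by
    have : x ∈ (U : Set N) := by
      rw [hU]
      exact Set.mem_iUnion₂.2 ⟨i, hi, hx⟩
    exact this
  have := K.chain_union U α (fun i => (S i).inside U) h0
    (fun i hi => K.mem_iso _ _ (Substructure.insideEquiv (hle i hi)) (hS i i le_rfl hi).mem_left)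
    (fun i j hij hj => ⟨fun _ hx => (hS i j hij hj).1 hx,
      (strong_inside_inside_iff (hle j hj)).2 (hS i j hij hj).2⟩)
    (fun δ hδ hl => by
      ext x
      have := Set.ext_iff.1 (hlim δ hδ hl) x
      simpa [Substructure.mem_inside] using this)
    (by
      ext x
      have := Set.ext_iff.1 hU x
      simpa [Substructure.mem_inside] using this)
  exact ⟨this.1, fun i hi => ⟨hle i hi, this.2 i hi⟩⟩

theorem StrongSub.chain_bound {α : Ordinal.{u}} {S : Ordinal.{u} → L.Substructure N}
    (h0 : α ≠ 0) (hS : ∀ i j, i ≤ j → j < α → K.StrongSub (S i) (S j))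
    (hlim : ∀ δ < α, Order.IsSuccLimit δ → (S δ : Set N) = ⋃ i < δ, (S i : Set N))
    (hU : (U : Set N) = ⋃ i < α, (S i : Set N)) (hT : ∀ i < α, K.StrongSub (S i) T) :
    K.StrongSub U T := by
  refine ⟨fun x hx => ?_, K.chain_bound T α (fun i => (S i).inside T) _ h0
    (fun i hi => K.mem_left _ _ (hT i hi).2)
    (fun i j hij hj => ⟨fun _ hx => (hS i j hij hj).1 hx,
      (strong_inside_inside_iff (hT j hj).1).2 (hS i j hij hj).2⟩) ?_ ?_
    fun i hi => (hT i hi).2⟩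
  · have hx' : x ∈ (U : Set N) := hx
    rw [hU] at hx'
    obtain ⟨i, hi, hx'⟩ := Set.mem_iUnion₂.1 hx'
    exact (hT i hi).1 hx'
  · intro δ hδ hl
    ext x
    have := Set.ext_iff.1 (hlim δ hδ hl) x
    simpa [Substructure.mem_inside] using this
  · ext x
    have := Set.ext_iff.1 hU x
    simpa [Substructure.mem_inside] using this

end StrongSub

/-! ### Directed unions -/

section directed

variable {K} {N : Type u} [L.Structure N]

/-- The union of the substructures `b s` for the finite `s ⊆ A`, where `b` is monotone. -/
def finsetUnion {α : Type u} {b : Finset α → L.Substructure N} (hb : Monotone b)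
    (A : Set α) : L.Substructure N where
  carrier := {x | ∃ s : Finset α, ↑s ⊆ A ∧ x ∈ b s}
  fun_mem {n} f x hx := by
    classical
    choose s hs hxs using hx
    refine ⟨Finset.univ.biUnion s, ?_, ?_⟩
    · simpa using hs
    · exact (b _).fun_mem f x fun i => hb (Finset.subset_biUnion_of_mem s (Finset.mem_univ i)) (hxs i)

theorem mem_finsetUnion {α : Type u} {b : Finset α → L.Substructure N} {hb : Monotone b}
    {A : Set α} {x : N} : x ∈ finsetUnion hb A ↔ ∃ s : Finset α, ↑s ⊆ A ∧ x ∈ b s :=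
  Iff.rfl

theorem finsetUnion_coe {α : Type u} {b : Finset α → L.Substructure N} (hb : Monotone b)
    (s : Finset α) : finsetUnion hb ↑s = b s := by
  ext x
  exact ⟨fun ⟨t, ht, hx⟩ => hb (Finset.coe_subset.1 ht) hx, fun hx => ⟨s, subset_rfl, hx⟩⟩

/-- The initial segments of an enumeration of an infinite set in order type its cardinal. -/
theorem exists_ordinal_filtration {α : Type u} (A : Set α) :
    ∃ F : Ordinal.{u} → Set α, Monotone F ∧ (∀ i < (#A).ord, F i ⊆ A ∧ #(F i) < #A) ∧
      ∀ δ ≤ (#A).ord, Order.IsSuccLimit δ → ∀ s : Finset α, ↑s ⊆ (if δ = (#A).ord then A else F δ) →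
        ∃ i < δ, ↑s ⊆ F i := by
  obtain ⟨r, hwo, hr⟩ := Cardinal.exists_ord_eq A
  -- `F i` consists of the elements of rank below `i`. The last clause includes δ = `(#A).ord`, so
  -- that it gives both continuity and exhaustion of `A`.
  refine ⟨fun i => {x | ∃ h : x ∈ A, Ordinal.typein r ⟨x, h⟩ < i},
    fun i j hij x ⟨h, hx⟩ => ⟨h, hx.trans_le hij⟩, fun i hi => ⟨fun x ⟨h, _⟩ => h, ?_⟩, ?_⟩
  · refine lt_of_le_of_lt ?_ (Cardinal.lt_ord.1 hi)
    have hinj : Function.Injective (fun x : {x | ∃ h : x ∈ A, Ordinal.typein r ⟨x, h⟩ < i} =>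
        (⟨Ordinal.typein r ⟨x.1, x.2.1⟩, x.2.2⟩ : Set.Iio i)) := by
      rintro ⟨x, hx, hx'⟩ ⟨y, hy, hy'⟩ hxy
      have := Ordinal.typein_injective r (congrArg Subtype.val hxy)
      simpa using this
    have := Cardinal.lift_mk_le_lift_mk_of_injective hinj
    rw [Cardinal.mk_Iio_ordinal, Cardinal.lift_lift] at this
    exact Cardinal.lift_le.1 this
  · intro δ hδ hl s hs
    have hs' : ∀ x ∈ s, ∃ h : x ∈ A, Ordinal.typein r ⟨x, h⟩ < δ := by
      intro x hx
      have := hs hx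
      split_ifs at this with h
      · exact ⟨this, by rw [h, hr]; exact Ordinal.typein_lt_type r _⟩
      · exact this
    clear hs
    induction s using Finset.cons_induction with
    | empty => exact ⟨0, hl.bot_lt, by simp⟩
    | cons a s ha ih =>
      obtain ⟨i, hi, his⟩ := ih fun x hx => hs' x (Finset.mem_cons_of_mem hx)
      obtain ⟨h, hx⟩ := hs' a (Finset.mem_cons_self a s)
      refine ⟨max i (Order.succ (Ordinal.typein r ⟨a, h⟩)), max_lt hi (hl.succ_lt hx), ?_⟩
      rw [Finset.coe_cons]
      rintro x (rfl | hx)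
      · exact ⟨h, lt_max_of_lt_right (Order.lt_succ _)⟩
      · obtain ⟨h', hx'⟩ := his hx
        exact ⟨h', lt_max_of_lt_left hx'⟩

/-- Induction on |A| reduces directed systems to chains. For finite `A` the union is `b A`. For
infinite `A`, the unions over the smaller sets `F i` form a continuous ≺-chain, to which the chain
axioms apply. The two claims are proved together because both are needed to see that this is a
≺-chain. -/
theorem finsetUnion_strong {α : Type u} {b : Finset α → L.Substructure N} (hb : Monotone b)
    (hs : ∀ s t, s ⊆ t → K.StrongSub (b s) (b t)) (A : Set α) :
    (∀ s : Finset α, ↑s ⊆ A → K.StrongSub (b s) (finsetUnion hb A)) ∧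
      ∀ T : L.Substructure N, (∀ s : Finset α, ↑s ⊆ A → K.StrongSub (b s) T) →
        K.StrongSub (finsetUnion hb A) T := by
  induction hc : #A using WellFoundedLT.induction generalizing A with
  | ind c ih =>
  subst hc
  obtain hA | hA := lt_or_ge #A ℵ₀
  · lift A to Finset α using Cardinal.lt_aleph0_iff_set_finite.1 hA
    rw [finsetUnion_coe]
    exact ⟨fun s h => hs s A (Finset.coe_subset.1 h), fun T hT => hT A subset_rfl⟩
  · obtain ⟨F, hF, hFA, hlim⟩ := exists_ordinal_filtration A
    have hlo : Order.IsSuccLimit (#A).ord := Cardinal.isSuccLimit_ord hA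
    have h0 : (#A).ord ≠ 0 := hlo.bot_lt.ne'
    have ih' : ∀ i < (#A).ord, _ := fun i hi => ih _ (hFA i hi).2 (F i) rfl
    have hS : ∀ i j, i ≤ j → j < (#A).ord →
        K.StrongSub (finsetUnion hb (F i)) (finsetUnion hb (F j)) := fun i j hij hj =>
      (ih' i (hij.trans_lt hj)).2 _ fun s hsi => (ih' j hj).1 s (hsi.trans (hF hij))
    have hcont : ∀ δ < (#A).ord, Order.IsSuccLimit δ →
        (finsetUnion hb (F δ) : Set N) = ⋃ i < δ, (finsetUnion hb (F i) : Set N) := by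
      intro δ hδ hl
      ext x
      simp only [Set.mem_iUnion, SetLike.mem_coe, mem_finsetUnion]
      constructor
      · rintro ⟨s, hs, hx⟩
        obtain ⟨i, hi, hsi⟩ := hlim δ hδ.le hl s (by rwa [if_neg hδ.ne])
        exact ⟨i, hi, s, hsi, hx⟩
      · rintro ⟨i, hi, s, hs, hx⟩
        exact ⟨s, hs.trans (hF hi.le), hx⟩
    have hU : (finsetUnion hb A : Set N) = ⋃ i < (#A).ord, (finsetUnion hb (F i) : Set N) := by
      ext x
      simp only [Set.mem_iUnion, SetLike.mem_coe, mem_finsetUnion]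
      constructor
      · rintro ⟨s, hs, hx⟩
        obtain ⟨i, hi, hsi⟩ := hlim _ le_rfl hlo s (by rwa [if_pos rfl])
        exact ⟨i, hi, s, hsi, hx⟩
      · rintro ⟨i, hi, s, hs, hx⟩
        exact ⟨s, hs.trans (hFA i hi).1, hx⟩
    constructor
    · intro s hsA
      obtain ⟨i, hi, hsi⟩ := hlim _ le_rfl hlo s (by rwa [if_pos rfl])
      exact ((ih' i hi).1 s hsi).trans ((StrongSub.chain_union h0 hS hcont hU).2 i hi)
    · intro T hT
      exact StrongSub.chain_bound h0 hS hcont hU fun i hi =>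
        (ih' i hi).2 T fun s hsi => hT s (hsi.trans (hFA i hi).1)

/-- In a directed set, finite subsets have upper bounds that depend monotonically on them. -/
theorem exists_monotone_finset {β : Type u} [Preorder β] [IsDirectedOrder β] [Nonempty β] :
    ∃ b : Finset β → β, Monotone b ∧ ∀ x, x ≤ b {x} := by
  classical
  -- Recursion along ⊂: the bound for `s` is chosen above the elements of `s` and above the bounds
  -- already chosen for its finitely many proper subsets.
  have key : ∀ (s : Finset β) (f : ∀ t : Finset β, t ⊂ s → β),
      ∃ y, (∀ x ∈ s, x ≤ y) ∧ ∀ t ht, f t ht ≤ y := by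
    intro s f
    let F : s.ssubsets → β := fun t => f t.1 (Finset.mem_ssubsets.1 t.2)
    obtain ⟨y, hy⟩ := Finset.exists_le (s ∪ s.ssubsets.attach.image F)
    refine ⟨y, fun x hx => hy x (Finset.mem_union_left _ hx), fun t ht => hy _ ?_⟩
    exact Finset.mem_union_right _ (Finset.mem_image.2
      ⟨⟨t, Finset.mem_ssubsets.2 ht⟩, Finset.mem_attach _ _, rfl⟩)
  choose g hg hg' using key
  have hb : ∀ s, Finset.strongInduction g s = g s fun t _ => Finset.strongInduction g t :=
    Finset.strongInduction_eq g
  refine ⟨Finset.strongInduction g, fun s t hst => ?_, fun x => ?_⟩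
  · obtain rfl | hst := eq_or_ssubset_of_subset hst
    · exact le_rfl
    · rw [hb t]
      exact hg' t (fun t _ => Finset.strongInduction g t) s hst
  · rw [hb]
    exact hg _ _ x (Finset.mem_singleton_self x)

variable {G : Set (L.Substructure N)} {U : L.Substructure N}

/-- Monotone upper bounds reindex `G` by the finite subsets of `G`, which is the case treated by
`finsetUnion_strong`. -/
theorem directed_union (hne : G.Nonempty) (hdir : DirectedOn (· ≤ ·) G)
    (hG : ∀ S ∈ G, ∀ T ∈ G, S ≤ T → K.StrongSub S T) (hU : ∀ x, x ∈ U ↔ ∃ S ∈ G, x ∈ S) :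
    (∀ S ∈ G, K.StrongSub S U) ∧
      ∀ T, (∀ S ∈ G, K.StrongSub S T) → K.StrongSub U T := by
  have : Nonempty G := hne.to_subtype
  have : IsDirectedOrder G := ⟨fun x y => by
    obtain ⟨z, hz, hxz, hyz⟩ := hdir x x.2 y y.2
    exact ⟨⟨z, hz⟩, hxz, hyz⟩⟩
  obtain ⟨b, hb, hxb⟩ := exists_monotone_finset (β := G)
  have hb' : Monotone fun s => (b s : L.Substructure N) := fun s t h => hb h
  have hUeq : U = finsetUnion hb' Set.univ := by
    ext x
    rw [hU, mem_finsetUnion]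
    constructor
    · rintro ⟨S, hS, hx⟩
      exact ⟨{⟨S, hS⟩}, Set.subset_univ _, hxb ⟨S, hS⟩ hx⟩
    · rintro ⟨s, -, hx⟩
      exact ⟨b s, (b s).2, hx⟩
  rw [hUeq]
  have key := finsetUnion_strong hb' (K := K)
    (fun s t h => hG _ (b s).2 _ (b t).2 (hb h)) Set.univ
  refine ⟨fun S hS => ?_, fun T hT => key.2 T fun s _ => hT _ (b s).2⟩
  exact (hG S hS _ (b {⟨S, hS⟩}).2 (hxb ⟨S, hS⟩)).trans (key.1 _ (Set.subset_univ _))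

end directed

end AEC

/-! ### Regularity of κ and fine ultrafilters -/

open Filter in
/-- If `κ` is singular, a `κ`-complete filter is closed under intersections of `κ` sets. -/
theorem eventually_forall_of_cof_lt {α : Type u} {κ : Cardinal.{u}} (hκ : ℵ₀ ≤ κ)
    (hcof : κ.ord.cof < κ) (F : Filter α) [CardinalInterFilter F κ]
    {p : α → κ.ord.ToType → Prop} (hp : ∀ x, ∀ᶠ a in F, p a x) : ∀ᶠ a in F, ∀ x, p a x := by
  obtain ⟨B, hB, hBc⟩ := Order.exists_cof_eq (α := κ.ord.ToType)
  rw [Ordinal.cof_toType] at hBc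
  -- κ is a union of fewer than κ initial segments, each of size below κ, so completeness is applied
  -- twice.
  have h : ∀ᶠ a in F, ∀ b ∈ B, ∀ x ∈ Set.Iic b, p a x := by
    refine (eventually_cardinal_ball (hBc ▸ hcof)).2 fun b _ =>
      (eventually_cardinal_ball (c := κ) ?_).2 fun x _ => hp x
    rw [← Set.Iio_insert]
    refine Cardinal.mk_insert_le.trans_lt (Cardinal.add_lt_of_lt hκ ?_ ?_)
    · simpa using Cardinal.mk_Iio_lt b
    · exact Cardinal.one_lt_aleph0.trans_le hκ
  filter_upwards [h] with a ha x
  obtain ⟨b, hb, hxb⟩ := hB x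
  exact ha b hb x hxb

open Filter in
-- For singular κ, a κ-complete ultrafilter on 2^κ decides all κ coordinates simultaneously and so
-- concentrates on one point. But it can be taken to contain all sets with complement of size at
-- most κ, a proper filter by Cantor's theorem.
theorem IsStronglyCompact.isRegular {κ : Cardinal.{u}} (hκ : IsStronglyCompact κ) :
    κ.IsRegular := by
  refine ⟨hκ.1.le, ?_⟩
  by_contra! hcof
  have hreg : (Order.succ κ).IsRegular := Cardinal.isRegular_succ hκ.1.le
  let F : Filter (κ.ord.ToType → Prop) := cocardinal _ hreg
  have hF : F.NeBot := by
    have : ∃ᶠ _ in F, True := by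
      rw [frequently_cocardinal, Order.succ_le_iff]
      simpa using Cardinal.cantor κ
    exact frequently_true_iff_neBot F |>.1 this
  have : CardinalInterFilter F κ :=
    CardinalInterFilter.of_cardinalInterFilter_of_le F (Order.le_succ κ)
  obtain ⟨U, hUF, hU⟩ := hκ.2 _ F hF this
  have hb : ∀ x, ∃ b : Prop, ∀ᶠ f : κ.ord.ToType → Prop in U, f x = b := fun x =>
    (U.em fun f => f x).elim (fun h => ⟨True, h.mono fun f hf => eq_true hf⟩)
      fun h => ⟨False, h.mono fun f hf => eq_false hf⟩
  choose b hb using hb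
  have h1 : ∀ᶠ f in U, f = b := by
    have := eventually_forall_of_cof_lt hκ.1.le hcof (U : Filter (κ.ord.ToType → Prop)) hb
    exact this.mono fun f hf => funext hf
  have h2 : ∀ᶠ f in U, f ≠ b := by
    refine hUF ?_
    change ({f | f ≠ b} : Set _) ∈ cocardinal _ hreg
    rw [mem_cocardinal]
    have : {f | f ≠ b}ᶜ = {b} := by
      ext
      simp
    rw [this, Cardinal.mk_singleton]
    exact Cardinal.one_lt_aleph0.trans_le hreg.aleph0_le
  obtain ⟨f, h, h'⟩ := (h1.and h2).exists
  exact h' h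

open Filter in
/-- If `κ` is strongly compact and each set of fewer than `κ` elements of `β` lies in some `s i`,
then there is a `κ`-complete ultrafilter for which each `b ∈ β` lies in almost all `s i`. -/
theorem IsStronglyCompact.exists_fine {κ : Cardinal.{u}} (hκ : IsStronglyCompact κ)
    {ι β : Type u} (s : ι → Set β) (hs : ∀ A : Set β, #A < κ → ∃ i, A ⊆ s i) :
    ∃ U : Ultrafilter ι, CardinalInterFilter (U : Filter ι) κ ∧ ∀ b, ∀ᶠ i in U, b ∈ s i := by
  have hreg := hκ.isRegular
  -- The filter generated by the cones {i | A ⊆ s i} with |A| < κ. Regularity keeps a union of fewer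
  -- than κ such `A` small, which makes it κ-complete.
  let F : Filter ι := Filter.ofCardinalInter
    {X | ∃ A : Set β, #A < κ ∧ ∀ i, A ⊆ s i → i ∈ X} (hreg.nat_lt 2)
    (fun S hS hSF => by
      choose A hA hAS using fun X : S => hSF X.2
      refine ⟨⋃ X, A X, ?_, fun i hi X hX => hAS ⟨X, hX⟩ i ((Set.subset_iUnion A _).trans hi)⟩
      exact (Cardinal.card_iUnion_lt_iff_forall_of_isRegular hreg hS).2 hA)
    fun X Y ⟨A, hA, h⟩ hXY => ⟨A, hA, fun i hi => hXY (h i hi)⟩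
  have hF : F.NeBot := by
    refine Filter.neBot_iff.2 fun h => ?_
    obtain ⟨A, hA, h⟩ : ∅ ∈ F := h ▸ Filter.mem_bot
    obtain ⟨i, hi⟩ := hs A hA
    exact h i hi
  obtain ⟨U, hUF, hU⟩ := hκ.2 _ F hF (cardinalInter_ofCardinalInter ..)
  refine ⟨U, hU, fun b => hUF ⟨{b}, ?_, fun i hi => hi rfl⟩⟩
  rw [Cardinal.mk_singleton]
  exact hreg.nat_lt 1

/-! ### Ultraproducts, Łoś's theorem and axiomatizable classes -/

section Ultraproduct

open Filter

variable {L : FirstOrder.Language.{u, u}} {ι : Type u} {U : Ultrafilter ι} {N : ι → Type u}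
  [∀ i, L.Structure (N i)]

namespace FirstOrder.Language.Ultraproduct

variable (U) in
/-- The class of a sequence in the ultraproduct. -/
def mk (x : ∀ i, N i) : (U : Filter ι).Product N :=
  (x : (U : Filter ι).Product N)

theorem mk_eq_mk {x y : ∀ i, N i} : mk U x = mk U y ↔ ∀ᶠ i in U, x i = y i :=
  Quotient.eq''

theorem funMap_mk {n : ℕ} (f : L.Functions n) (x : Fin n → ∀ i, N i) :
    Structure.funMap f (fun k => mk U (x k)) = mk U fun i => Structure.funMap f fun k => x k i :=
  funMap_cast f x

theorem relMap_mk {n : ℕ} (R : L.Relations n) (x : Fin n → ∀ i, N i) :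
    Structure.RelMap R (fun k => mk U (x k)) ↔ ∀ᶠ i in U, Structure.RelMap R fun k => x k i :=
  relMap_quotient_mk' ..

theorem realize_mk {n : ℕ} (t : L.Term (Fin n)) (x : Fin n → ∀ i, N i) :
    t.realize (fun k => mk U (x k)) = mk U fun i => t.realize fun k => x k i :=
  term_realize_cast x t

theorem exists_rep (x : (U : Filter ι).Product N) : ∃ y : ∀ i, N i, mk U y = x :=
  Quotient.exists_rep x

variable (U) in
/-- The embedding into an ultraproduct given by embeddings into its factors. -/
def lift {M : Type u} [L.Structure M] (f : ∀ i, M ↪[L] N i) :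
    M ↪[L] (U : Filter ι).Product N where
  toFun m := mk U fun i => f i m
  inj' m m' h := by
    obtain ⟨i, hi⟩ := (mk_eq_mk.1 h).exists
    exact (f i).injective hi
  map_fun' g x := by
    refine Eq.trans ?_ (funMap_mk g fun k i => f i (x k)).symm
    exact mk_eq_mk.2 (.of_forall fun i => (f i).map_fun g x)
  map_rel' R x := by
    refine (relMap_mk R fun k i => f i (x k)).trans ?_
    have : ∀ i, Structure.RelMap R (fun k => f i (x k)) ↔ Structure.RelMap R x :=
      fun i => (f i).map_rel R x
    simp only [this, eventually_const]

end FirstOrder.Language.Ultraproduct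

open FirstOrder.Language.Ultraproduct

theorem InfFormula.realize_equiv {κ : Cardinal.{u}} {M M' : Type u} [L.Structure M]
    [L.Structure M'] (e : M ≃[L] M') {n : ℕ} (φ : InfFormula L κ n) (v : Fin n → M) :
    φ.Realize (fun k => e (v k)) ↔ φ.Realize v := by
  induction φ with
  | equal t s =>
    simp only [InfFormula.Realize]
    have := fun t : L.Term (Fin _) => HomClass.realize_term e (t := t) (v := v)
    simp only [Function.comp_def] at this
    rw [this, this, e.injective.eq_iff]
  | rel R ts =>
    simp only [InfFormula.Realize]
    have := fun t : L.Term (Fin _) => HomClass.realize_term e (t := t) (v := v)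
    simp only [Function.comp_def] at this
    simp only [this]
    exact e.map_rel R _
  | neg φ ih => exact not_congr (ih v)
  | conj ι h φ ih => exact forall_congr' fun i => ih i v
  | all φ ih =>
    simp only [InfFormula.Realize]
    refine (e.toEquiv.forall_congr fun {x} => ?_).symm
    rw [← ih]
    have : (fun k => e ((Fin.snoc v x : Fin (_ + 1) → M) k)) =
        Fin.snoc (fun k => e (v k)) (e x) := Fin.comp_snoc (g := e) v x
    rw [this]
    rfl

/-- Łoś's theorem for `L_{κ,ω}` and `κ`-complete ultrafilters. -/
theorem InfFormula.realize_ultraproduct {κ : Cardinal.{u}} [CardinalInterFilter (U : Filter ι) κ]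
    [∀ i, Nonempty (N i)] {n : ℕ} (φ : InfFormula L κ n) (v : Fin n → ∀ i, N i) :
    φ.Realize (fun k => mk U (v k)) ↔
      ∀ᶠ i in U, φ.Realize fun k => v k i := by
  induction φ with
  | equal t s =>
    simp only [InfFormula.Realize]
    rw [realize_mk, realize_mk, mk_eq_mk]
  | rel R ts =>
    simp only [InfFormula.Realize, realize_mk]
    exact relMap_mk R _
  | neg φ ih =>
    simp only [InfFormula.Realize]
    rw [ih v, Ultrafilter.eventually_not]
  | conj J h φ ih =>
    simp only [InfFormula.Realize, ih]
    exact (eventually_cardinal_forall h).symm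
  | @all n φ ih =>
    simp only [InfFormula.Realize]
    have key : ∀ x : ∀ i, N i,
        φ.Realize (Fin.snoc (fun k => mk U (v k))
          (mk U x) : Fin (n + 1) → _) ↔
        ∀ᶠ i in U, φ.Realize (Fin.snoc (fun k => v k i) (x i) : Fin (n + 1) → N i) := by
      intro x
      have := ih (Fin.snoc v x : Fin (n + 1) → ∀ i, N i)
      have h1 : (fun k => mk U ((Fin.snoc v x : Fin (n + 1) → ∀ i, N i) k)) = Fin.snoc (fun k => mk U (v k)) (mk U x) :=
        Fin.comp_snoc (g := mk U) v x
      have h2 : ∀ i, (fun k => (Fin.snoc v x : Fin (n + 1) → ∀ i, N i) k i) =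
          Fin.snoc (fun k => v k i) (x i) := fun i =>
        Fin.comp_snoc (g := fun y : ∀ i, N i => y i) v x
      simp only [h1, h2] at this
      exact this
    constructor
    · intro h
      by_contra hU
      rw [← Ultrafilter.eventually_not] at hU
      -- A counterexample is chosen in every factor that has one, and an arbitrary element
      -- elsewhere; this is where the factors must be nonempty.
      have : ∀ i, ∃ x : N i, (¬ ∀ x, φ.Realize (Fin.snoc (fun k => v k i) x : Fin (n + 1) → N i)) →
          ¬ φ.Realize (Fin.snoc (fun k => v k i) x : Fin (n + 1) → N i) := by
        intro i
        by_cases hi : ∀ x, φ.Realize (Fin.snoc (fun k => v k i) x : Fin (n + 1) → N i)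
        · exact ⟨Classical.arbitrary _, fun h => absurd hi h⟩
        · obtain ⟨x, hx⟩ := not_forall.1 hi
          exact ⟨x, fun _ => hx⟩
      choose x hx using this
      obtain ⟨i, hi, hi'⟩ := (((key x).1 (h _)).and hU).exists
      exact hx i hi' hi
    · intro h x
      obtain ⟨x, rfl⟩ := exists_rep x
      exact (key x).2 (h.mono fun i hi => hi (x i))

namespace AEC

/-- Ultraproducts of `K`-embeddings into nonempty models by the ultrafilter `U` are `K`-embeddings. -/
def ClosedUnderUltraproduct (K : AEC L) (U : Ultrafilter ι) : Prop :=
  ∀ (M : Type u) [L.Structure M] (N : ι → Type u) [∀ i, L.Structure (N i)] [∀ i, Nonempty (N i)]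
    (f : ∀ i, M ↪[L] N i), (∀ i, K.IsEmb (f i)) → K.IsEmb (Ultraproduct.lift U f)

theorem IsModClass.closedUnderUltraproduct {K : AEC L} {κ : Cardinal.{u}} (hK : K.IsModClass κ)
    (hU : CardinalInterFilter (U : Filter ι) κ) : K.ClosedUnderUltraproduct U := by
  intro M _ N _ _ f hf
  obtain ⟨T, F, hMem, hStrong⟩ := hK
  have hMi : ∀ i, K.Mem (N i) := fun i => K.mem_right _ _ (hf i)
  obtain ⟨i₀⟩ := U.neBot.nonempty
  refine (hStrong _ _).2 ⟨?_, ?_, ?_⟩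
  · exact K.mem_iso _ _ ((lift U f).equivRange.comp (f i₀).equivRange.symm) (K.mem_left _ _ (hf i₀))
  · refine (hMem _).2 ⟨⟨Ultraproduct.mk U fun i => Classical.arbitrary (N i)⟩, fun φ hφ => ?_⟩
    have := φ.realize_ultraproduct (U := U) (N := N) Fin.elim0
    rw [show (Fin.elim0 : Fin 0 → (U : Filter ι).Product N) = _ from Subsingleton.elim _ _, this]
    refine .of_forall fun i => ?_
    convert ((hMem _).1 (hMi i)).2 φ hφ
  · intro n φ hφ v
    obtain ⟨w, rfl⟩ : ∃ w : Fin n → M, v = fun k => (lift U f).equivRange (w k) :=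
      ⟨fun k => (lift U f).equivRange.symm (v k), by simp⟩
    rw [φ.realize_equiv (lift U f).equivRange w]
    have h1 := φ.realize_ultraproduct (U := U) fun k i => f i (w k)
    refine Iff.trans ?_ h1.symm
    have h2 : ∀ i, φ.Realize (fun k => f i (w k)) ↔ φ.Realize w := fun i => by
      have := ((hStrong _ _).1 (hf i)).2.2 n φ hφ fun k => (f i).equivRange (w k)
      rw [φ.realize_equiv (f i).equivRange w] at this
      exact this.symm
    simp only [h2, eventually_const]

end AEC

end Ultraproduct

/-! ### Ultraproducts of small submodels and the case LS(K) < κ -/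

section Ultraproduct

open Filter

variable {L : FirstOrder.Language.{u, u}} {ι : Type u} {U : Ultrafilter ι} {N : ι → Type u}
  [∀ i, L.Structure (N i)] {κ : Cardinal.{u}}

/-- A partition into fewer than κ pieces has a piece in a κ-complete ultrafilter. -/
theorem Ultrafilter.exists_eventually_of_lt (hU : CardinalInterFilter (U : Filter ι) κ) {A : Type u}
    (hA : #A < κ) {p : ι → A → Prop} (h : ∀ᶠ i in U, ∃ a, p i a) : ∃ a, ∀ᶠ i in U, p i a := by
  by_contra! hne
  have : ∀ᶠ i in U, ∀ a, ¬ p i a :=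
    (eventually_cardinal_forall hA).2 hne
  obtain ⟨i, ⟨a, ha⟩, hi⟩ := (h.and this).exists
  exact hi a ha

theorem Ultrafilter.eventually_iff_of_iff {p : ι → Prop} {q : Prop} (h : (∀ᶠ i in U, p i) ↔ q) :
    ∀ᶠ i in U, (p i ↔ q) := by
  by_cases hq : q
  · simpa only [hq, iff_true] using h
  · simpa only [hq, iff_false, Ultrafilter.eventually_not] using h

theorem Ultrafilter.eventually_forall_of_forall_eventually {N : ι → Type*} [∀ i, Nonempty (N i)]
    {p : ∀ i, N i → Prop} (h : ∀ y : ∀ i, N i, ∀ᶠ i in U, p i (y i)) :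
    ∀ᶠ i in U, ∀ z, p i z := by
  have : ∀ i, ∃ z : N i, p i z → ∀ z, p i z := fun i => by
    by_cases hi : ∀ z, p i z
    · exact ⟨Classical.arbitrary _, fun _ => hi⟩
    · obtain ⟨z, hz⟩ := not_forall.1 hi
      exact ⟨z, fun h => absurd h hz⟩
  choose y hy using this
  exact (h y).mono hy

namespace FirstOrder.Language.Ultraproduct

variable (U) in
/-- The ultraproduct of substructures, as a substructure of the ultraproduct. -/
def prodSub (S : ∀ i, L.Substructure (N i)) : L.Substructure ((U : Filter ι).Product N) where
  carrier := {x | ∃ y, (∀ᶠ i in U, y i ∈ S i) ∧ mk U y = x}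
  fun_mem {n} f x hx := by
    choose y hy hyx using hx
    refine ⟨_, ?_, (funMap_mk f y).symm.trans (by simp only [hyx])⟩
    filter_upwards [eventually_all.2 hy] with i hi
    exact (S i).fun_mem f _ hi

theorem mk_mem_prodSub {S : ∀ i, L.Substructure (N i)} {y : ∀ i, N i} :
    mk U y ∈ prodSub U S ↔ ∀ᶠ i in U, y i ∈ S i := by
  constructor
  · rintro ⟨z, hz, hzy⟩
    filter_upwards [hz, mk_eq_mk.1 hzy] with i hi hi'
    rwa [← hi']
  · exact fun h => ⟨y, h, rfl⟩

/-- With all `T i` injected into one set of size c < κ, every sequence has an almost constant code,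
and that code determines its class. -/
theorem mk_prodSub_le (hU : CardinalInterFilter (U : Filter ι) κ) {T : ∀ i, L.Substructure (N i)}
    {c : Cardinal.{u}} (hc : c < κ) (hT : ∀ i, #(T i) ≤ c) : #(prodSub U T) ≤ c := by
  have : ∀ i, ∃ e : T i → c.out, Function.Injective e := fun i => by
    have := hT i
    rw [← Cardinal.mk_out c] at this
    obtain ⟨e⟩ := this
    exact ⟨e, e.injective⟩
  choose e he using this
  choose r hr using fun x : prodSub U T => exists_rep x.1
  have hrT : ∀ x, ∀ᶠ i in U, r x i ∈ T i := fun x => mk_mem_prodSub.1 ((hr x).symm ▸ x.2)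
  have : ∀ x, ∃ a, ∀ᶠ i in U, ∃ h : r x i ∈ T i, e i ⟨r x i, h⟩ = a := fun x =>
    Ultrafilter.exists_eventually_of_lt hU (by rwa [Cardinal.mk_out])
      ((hrT x).mono fun i hi => ⟨_, hi, rfl⟩)
  choose g hg using this
  rw [← Cardinal.mk_out c]
  refine Cardinal.mk_le_of_injective (f := g) fun x y hxy => Subtype.ext ?_
  rw [← hr x, ← hr y, mk_eq_mk]
  filter_upwards [hg x, hg y] with i ⟨h, hi⟩ ⟨h', hi'⟩
  exact congrArg Subtype.val (he i (hi.trans (hxy.trans hi'.symm)))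

theorem le_of_prodSub_le [∀ i, Nonempty (N i)] {S T : ∀ i, L.Substructure (N i)}
    (h : prodSub U S ≤ prodSub U T) : ∀ᶠ i in U, S i ≤ T i := by
  refine Ultrafilter.eventually_forall_of_forall_eventually (p := fun i z => z ∈ S i → z ∈ T i)
    fun y => ?_
  rw [Ultrafilter.eventually_imp]
  exact fun hy => mk_mem_prodSub.1 (h (mk_mem_prodSub.2 hy))

/-- A small ultraproduct by a `κ`-complete ultrafilter is isomorphic to almost all its factors. -/
theorem eventually_exists_equiv [∀ i, Nonempty (N i)] (hU : CardinalInterFilter (U : Filter ι) κ)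
    (hκ : ℵ₀ < κ) (hL : L.card < κ) (S T : ∀ i, L.Substructure (N i)) (hT : #(prodSub U T) < κ) :
    ∀ᶠ i in U, ∃ e : prodSub U T ≃[L] T i, ∀ x, x.1 ∈ prodSub U S ↔ (e x : N i) ∈ S i := by
  -- With representatives fixed, the isomorphism at index `i` will be x ↦ `r x i`. Injectivity, the
  -- atomic relations and membership in `S` amount to fewer than κ conditions, so they hold
  -- simultaneously at almost all `i`.
  choose r hr using fun x : prodSub U T => exists_rep x.1
  have hω {A : Type} [Countable A] : #(ULift.{u} A) < κ := (Cardinal.mk_le_aleph0).trans_lt hκ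
  have hpow : ∀ n : ℕ, #(Fin n → prodSub U T) < κ := fun n => by
    obtain h | h := lt_or_ge #(prodSub U T) ℵ₀
    · have := Cardinal.lt_aleph0_iff_finite.1 h
      exact (Cardinal.lt_aleph0_of_finite _).trans hκ
    · refine lt_of_le_of_lt ?_ hT
      simpa using Cardinal.power_nat_le (n := n) h
  have hfun : ∀ n, #(L.Functions n) < κ := fun n => by
    refine (Cardinal.mk_le_of_injective (f := fun g => (Sum.inl ⟨n, g⟩ : L.Symbols)) ?_).trans_lt hL
    intro g g' h
    simpa using h
  have hrel : ∀ n, #(L.Relations n) < κ := fun n => by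
    refine (Cardinal.mk_le_of_injective (f := fun g => (Sum.inr ⟨n, g⟩ : L.Symbols)) ?_).trans_lt hL
    intro g g' h
    simpa using h
  have h1 : ∀ᶠ i in U, ∀ x, r x i ∈ T i :=
    (eventually_cardinal_forall hT).2 fun x => mk_mem_prodSub.1 ((hr x).symm ▸ x.2)
  have h2 : ∀ᶠ i in U, ∀ x y, r x i = r y i → x = y := by
    refine (eventually_cardinal_forall hT).2 fun x => (eventually_cardinal_forall hT).2 fun y => ?_
    rw [Ultrafilter.eventually_imp]
    intro h
    exact .of_forall fun _ => Subtype.ext (by rw [← hr x, ← hr y, mk_eq_mk.2 h])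
  -- Surjectivity quantifies over the factor, so completeness does not apply; a choice of
  -- counterexamples does.
  have h3 : ∀ᶠ i in U, ∀ z, z ∈ T i → ∃ x, r x i = z := by
    refine Ultrafilter.eventually_forall_of_forall_eventually
      (p := fun i z => z ∈ T i → ∃ x, r x i = z) fun y => ?_
    rw [Ultrafilter.eventually_imp]
    intro hy
    filter_upwards [mk_eq_mk.1 (hr ⟨mk U y, mk_mem_prodSub.2 hy⟩)] with i hi
    exact ⟨_, hi⟩
  have h4 : ∀ᶠ i in U, ∀ (n : ULift.{u} ℕ) (R : L.Relations n.down) (t : Fin n.down → prodSub U T),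
      Structure.RelMap R (fun k => r (t k) i) ↔ Structure.RelMap R t := by
    refine (eventually_cardinal_forall hω).2 fun n =>
      (eventually_cardinal_forall (hrel _)).2 fun R =>
        (eventually_cardinal_forall (hpow _)).2 fun t => Ultrafilter.eventually_iff_of_iff ?_
    rw [← relMap_mk R fun k => r (t k)]
    simp only [hr]
    rfl
  have h5 : ∀ᶠ i in U, ∀ (n : ULift.{u} ℕ) (g : L.Functions n.down) (t : Fin n.down → prodSub U T),
      r (Structure.funMap g t) i = Structure.funMap g (fun k => r (t k) i) := by
    refine (eventually_cardinal_forall hω).2 fun n =>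
      (eventually_cardinal_forall (hfun _)).2 fun g =>
        (eventually_cardinal_forall (hpow _)).2 fun t => mk_eq_mk.1 ?_
    rw [← funMap_mk g fun k => r (t k)]
    simp only [hr]
    rfl
  have h6 : ∀ᶠ i in U, ∀ x, r x i ∈ S i ↔ x.1 ∈ prodSub U S := by
    refine (eventually_cardinal_forall hT).2 fun x => Ultrafilter.eventually_iff_of_iff ?_
    rw [← mk_mem_prodSub, hr]
  filter_upwards [h1, h2, h3, h4, h5, h6] with i h1 h2 h3 h4 h5 h6
  let e : prodSub U T ≃ T i := Equiv.ofBijective (fun x => ⟨r x i, h1 x⟩)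
    ⟨fun x y h => h2 x y (congrArg Subtype.val h), fun z => by
      obtain ⟨x, hx⟩ := h3 z z.2
      exact ⟨x, Subtype.ext hx⟩⟩
  exact ⟨⟨e, fun g t => Subtype.ext (h5 ⟨_⟩ g t), fun R t => h4 ⟨_⟩ R t⟩, fun x => (h6 x).symm⟩

end FirstOrder.Language.Ultraproduct

open FirstOrder.Language.Ultraproduct

namespace AEC

variable {K : AEC L}

theorem LS_spec (K : AEC L) : L.card + ℵ₀ ≤ K.LS ∧
    ∀ (M : Type u) [L.Structure M], K.Mem M → ∀ A : Set M,
      ∃ S : L.Substructure M, K.Strong M S ∧ A ⊆ S ∧ #S ≤ #A + K.LS :=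
  csInf_mem K.exists_LS

theorem aleph0_le_LS (K : AEC L) : ℵ₀ ≤ K.LS := le_add_self.trans K.LS_spec.1

theorem exists_strong_of_le {M : Type u} [L.Structure M] (hM : K.Mem M) (A : Set M)
    (hA : #A ≤ K.LS) : ∃ S : L.Substructure M, K.Strong M S ∧ A ⊆ S ∧ #S ≤ K.LS := by
  obtain ⟨S, hS, hAS, hc⟩ := K.LS_spec.2 M hM A
  exact ⟨S, hS, hAS, hc.trans (Cardinal.add_le_of_le K.aleph0_le_LS hA le_rfl)⟩

theorem exists_strong_sup {M : Type u} [L.Structure M] (hM : K.Mem M) {S T : L.Substructure M}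
    (hS : #S ≤ K.LS) (hT : #T ≤ K.LS) :
    ∃ R : L.Substructure M, K.Strong M R ∧ S ≤ R ∧ T ≤ R ∧ #R ≤ K.LS := by
  obtain ⟨R, hR, h, hc⟩ := exists_strong_of_le hM (S ∪ T : Set M)
    ((Cardinal.mk_union_le _ _).trans (Cardinal.add_le_of_le K.aleph0_le_LS hS hT))
  exact ⟨R, hR, Set.subset_union_left.trans h, Set.subset_union_right.trans h, hc⟩

/-- At some index the pair of ultraproducts is isomorphic to the pair (`T i`, `S i`), where
coherence inside `N i` gives S i ≺ T i. -/
theorem strongSub_prodSub [∀ i, Nonempty (N i)] (hU : CardinalInterFilter (U : Filter ι) κ)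
    (hκ : ℵ₀ < κ) (hLS : K.LS < κ) {S T : ∀ i, L.Substructure (N i)}
    (hS : ∀ i, K.Strong (N i) (S i)) (hT : ∀ i, K.Strong (N i) (T i)) (hTc : ∀ i, #(T i) ≤ K.LS)
    (h : prodSub U S ≤ prodSub U T) : K.StrongSub (prodSub U S) (prodSub U T) := by
  have hL : L.card < κ := (le_self_add.trans K.LS_spec.1).trans_lt hLS
  obtain ⟨i, hi, e, he⟩ := ((le_of_prodSub_le h).and (eventually_exists_equiv hU hκ hL S T
    ((mk_prodSub_le hU hLS hTc).trans_lt hLS))).exists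
  refine ⟨h, K.strong_of_equiv e.symm ?_ (K.coherence _ _ _ hi (hS i) (hT i))⟩
  intro x
  obtain ⟨x, rfl⟩ := e.surjective x
  rw [e.symm_apply_apply]
  exact (he x).symm

theorem IsEmb.strong_map {M N : Type u} [L.Structure M] [L.Structure N] {f : M ↪[L] N}
    (hf : K.IsEmb f) {S : L.Substructure M} (hS : K.Strong M S) : K.Strong N (S.map f.toHom) := by
  have := hf.comp (isEmb_subtype hS)
  unfold IsEmb at this
  convert this using 1
  ext x
  simp only [Substructure.mem_map, Hom.mem_range]
  exact ⟨fun ⟨y, hy, h⟩ => ⟨⟨y, hy⟩, h⟩, fun ⟨y, h⟩ => ⟨y, y.2, h⟩⟩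

theorem IsEmb.mem_left {M N : Type u} [L.Structure M] [L.Structure N] {f : M ↪[L] N}
    (hf : K.IsEmb f) : K.Mem M :=
  K.mem_iso _ _ f.equivRange.symm (K.mem_left _ _ hf)

theorem IsEmb.mem_right {M N : Type u} [L.Structure M] [L.Structure N] {f : M ↪[L] N}
    (hf : K.IsEmb f) : K.Mem N :=
  K.mem_right _ _ hf

/-- A sequence of elements of `S` is almost constant when |S| < κ, so the ultraproduct of the copies
of `S` adds nothing to its diagonal image. -/
theorem map_lift_eq_prodSub (hU : CardinalInterFilter (U : Filter ι) κ) {M : Type u}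
    [L.Structure M] (f : ∀ i, M ↪[L] N i) {S : L.Substructure M} (hS : #S < κ) :
    S.map (lift U f).toHom = prodSub U fun i => S.map (f i).toHom := by
  ext x
  obtain ⟨x, rfl⟩ := exists_rep x
  rw [mk_mem_prodSub]
  constructor
  · rintro ⟨m, hm, h⟩
    filter_upwards [mk_eq_mk.1 h] with i hi
    exact ⟨m, hm, hi⟩
  · intro h
    obtain ⟨m, hm⟩ := Ultrafilter.exists_eventually_of_lt hU hS
      (p := fun i m => f i m.1 = x i) (h.mono fun i ⟨m, hm, hi⟩ => ⟨⟨m, hm⟩, hi⟩)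
    exact ⟨m, m.2, mk_eq_mk.2 hm⟩

/-- In an ultraproduct of members of `K` by a `κ`-complete ultrafilter, where `LS(K) < κ`, the
ultraproducts of small models are strong. -/
theorem strongSub_prodSub_top [∀ i, Nonempty (N i)] (hU : CardinalInterFilter (U : Filter ι) κ)
    (hκ : ℵ₀ < κ) (hLS : K.LS < κ) (hN : ∀ i, K.Mem (N i)) {S : ∀ i, L.Substructure (N i)}
    (hS : ∀ i, K.Strong (N i) (S i)) (hSc : ∀ i, #(S i) ≤ K.LS) :
    K.StrongSub (prodSub U S) ⊤ := by
  refine (directed_union (G := {R | ∃ T : ∀ i, L.Substructure (N i), (∀ i, K.Strong (N i) (T i)) ∧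
    (∀ i, #(T i) ≤ K.LS) ∧ prodSub U T = R}) ⟨_, S, hS, hSc, rfl⟩ ?_ ?_ ?_).1 _ ⟨S, hS, hSc, rfl⟩
  · rintro _ ⟨T₁, -, hc₁, rfl⟩ _ ⟨T₂, -, hc₂, rfl⟩
    choose R hR h₁ h₂ hc using fun i => exists_strong_sup (hN i) (hc₁ i) (hc₂ i)
    refine ⟨_, ⟨R, hR, hc, rfl⟩, ?_, ?_⟩
    · rintro _ ⟨y, hy, rfl⟩
      exact mk_mem_prodSub.2 (hy.mono fun i hi => h₁ i hi)
    · rintro _ ⟨y, hy, rfl⟩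
      exact mk_mem_prodSub.2 (hy.mono fun i hi => h₂ i hi)
  · rintro _ ⟨T₁, h₁, -, rfl⟩ _ ⟨T₂, h₂, hc₂, rfl⟩ h
    exact strongSub_prodSub hU hκ hLS h₁ h₂ hc₂ h
  · intro x
    refine ⟨fun _ => ?_, fun _ => trivial⟩
    obtain ⟨x, rfl⟩ := exists_rep x
    choose T hT hxT hc using fun i => exists_strong_of_le (hN i) {x i}
      ((Cardinal.mk_singleton _).trans_le (Cardinal.one_le_aleph0.trans K.aleph0_le_LS))
    exact ⟨_, ⟨T, hT, hc, rfl⟩, mk_mem_prodSub.2 (.of_forall fun i => hxT i rfl)⟩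

/-- Since `M` may be large, its image is treated as the directed union of the images of its strong
submodels of size ≤ LS(K). Each of these is an ultraproduct of small submodels, hence strong, and
coherence makes the system a ≺-system. -/
theorem closedUnderUltraproduct_of_LS_lt (hU : CardinalInterFilter (U : Filter ι) κ) (hκ : ℵ₀ < κ)
    (hLS : K.LS < κ) : K.ClosedUnderUltraproduct U := by
  intro M _ N _ _ f hf
  obtain ⟨i₀⟩ := U.neBot.nonempty
  have hM : K.Mem M := (hf i₀).mem_left
  have hstrong : ∀ s : L.Substructure M, K.Strong M s → #s ≤ K.LS →
      K.StrongSub (s.map (lift U f).toHom) ⊤ := by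
    intro s hs hc
    rw [map_lift_eq_prodSub hU f (hc.trans_lt hLS)]
    exact strongSub_prodSub_top hU hκ hLS (fun i => (hf i).mem_right)
      (fun i => (hf i).strong_map hs) fun i => Cardinal.mk_image_le.trans hc
  refine strongSub_top_iff.1 ((directed_union (G := {R | ∃ s : L.Substructure M, K.Strong M s ∧
    #s ≤ K.LS ∧ s.map (lift U f).toHom = R}) ?_ ?_ ?_ ?_).2 ⊤ ?_)
  · obtain ⟨s, hs, -, hc⟩ := exists_strong_of_le hM ∅ (by simp)
    exact ⟨_, s, hs, hc, rfl⟩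
  · rintro _ ⟨s, -, hsc, rfl⟩ _ ⟨t, -, htc, rfl⟩
    obtain ⟨r, hr, hsr, htr, hrc⟩ := exists_strong_sup hM hsc htc
    exact ⟨_, ⟨r, hr, hrc, rfl⟩, Substructure.monotone_map hsr, Substructure.monotone_map htr⟩
  · rintro _ ⟨s, hs, hsc, rfl⟩ _ ⟨t, ht, htc, rfl⟩ hst
    exact (hstrong s hs hsc).coherence (hstrong t ht htc) hst
  · intro x
    constructor
    · rintro ⟨m, rfl⟩
      obtain ⟨s, hs, hms, hc⟩ := exists_strong_of_le hM {m}
        ((Cardinal.mk_singleton _).trans_le (Cardinal.one_le_aleph0.trans K.aleph0_le_LS))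
      exact ⟨_, ⟨s, hs, hc, rfl⟩, m, hms rfl, rfl⟩
    · rintro ⟨_, ⟨s, -, -, rfl⟩, m, -, rfl⟩
      exact ⟨m, rfl⟩
  · rintro _ ⟨s, hs, hc, rfl⟩
    exact hstrong s hs hc

theorem EssentiallyBelow.closedUnderUltraproduct (hK : K.EssentiallyBelow κ) (hκ : ℵ₀ < κ)
    (hU : CardinalInterFilter (U : Filter ι) κ) : K.ClosedUnderUltraproduct U :=
  hK.elim (closedUnderUltraproduct_of_LS_lt hU hκ) fun h => h.closedUnderUltraproduct hU

end AEC

end Ultraproduct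

/-! ### Amalgamation, Galois types and the conclusion -/

namespace AEC

variable {L : FirstOrder.Language.{u, u}} {K : AEC L}

theorem IsEmb.id {M : Type u} [L.Structure M] (hM : K.Mem M) :
    K.IsEmb (Embedding.refl L M) := by
  unfold IsEmb
  convert K.refl M hM
  exact Hom.range_id

/-- Universality places `N₁` in a monster; homogeneity over the image of `M` then places `N₂` there.
-/
theorem HasMonsterModel.amalgamation (hC : K.HasMonsterModel) {M N₁ N₂ : Type u} [L.Structure M]
    [L.Structure N₁] [L.Structure N₂] {f₁ : M ↪[L] N₁} {f₂ : M ↪[L] N₂} (h₁ : K.IsEmb f₁)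
    (h₂ : K.IsEmb f₂) :
    ∃ (C : Type u) (_ : L.Structure C) (g₁ : N₁ ↪[L] C) (g₂ : N₂ ↪[L] C),
      K.IsEmb g₁ ∧ K.IsEmb g₂ ∧ ∀ m, g₁ (f₁ m) = g₂ (f₂ m) := by
  obtain ⟨C, _, hC⟩ := hC (max #N₁ #N₂)
  obtain ⟨g₁, hg₁⟩ := hC.universal N₁ h₁.mem_right (le_max_left _ _)
  have h := hg₁.comp h₁
  let e := (g₁.comp f₁).equivRange
  have hj : K.IsEmb (f₂.comp e.symm.toEmbedding) := by
    unfold IsEmb at h₂ ⊢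
    convert h₂ using 1
    ext x
    simp only [Hom.mem_range]
    constructor
    · rintro ⟨y, rfl⟩
      exact ⟨e.symm y, rfl⟩
    · rintro ⟨y, rfl⟩
      refine ⟨e y, ?_⟩
      change f₂ (e.symm (e y)) = f₂ y
      rw [e.symm_apply_apply]
  obtain ⟨g₂, hg₂, hfix⟩ := hC.homogeneous _ h N₂ _ hj (le_max_right _ _)
  refine ⟨C, _, g₁, g₂, hg₁, hg₂, fun m => ?_⟩
  have := hfix (e m)
  change g₂ (f₂ (e.symm (e m))) = g₁ (f₁ m) at this
  rw [e.symm_apply_apply] at this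
  exact this.symm

/-- Two witnesses are composed by amalgamating their targets over the middle pretype's model. Hence
equal types have a one-step witness. -/
theorem Pretype.at_equivalence (hC : K.HasMonsterModel) (I M : Type u) [L.Structure M] :
    Equivalence (Pretype.AT (K := K) (I := I) (M := M)) where
  refl p := ⟨p.N, p.str, _, _, .id p.isEmb.mem_right, .id p.isEmb.mem_right, fun _ => rfl,
    fun _ => rfl⟩
  symm := fun ⟨N', s, f, g, hf, hg, hM, ha⟩ =>
    ⟨N', s, g, f, hg, hf, fun m => (hM m).symm, fun i => (ha i).symm⟩
  trans := by
    rintro p q r ⟨N₁, _, f₁, g₁, hf₁, hg₁, hM₁, ha₁⟩ ⟨N₂, _, f₂, g₂, hf₂, hg₂, hM₂, ha₂⟩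
    obtain ⟨C, _, h₁, h₂, hh₁, hh₂, hh⟩ := hC.amalgamation hg₁ hf₂
    refine ⟨C, _, h₁.comp f₁, h₂.comp g₂, hh₁.comp hf₁, hh₂.comp hg₂, fun m => ?_, fun i => ?_⟩
    · rw [Embedding.comp_apply, Embedding.comp_apply, hM₁, hh, hM₂]
    · rw [Embedding.comp_apply, Embedding.comp_apply, ha₁, hh, ha₂]

theorem Pretype.at_of_mk_eq (hC : K.HasMonsterModel) {I M : Type u} [L.Structure M]
    {p q : K.Pretype I M} (h : (Quot.mk _ p : K.GType I M) = Quot.mk _ q) : p.AT q :=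
  (at_equivalence hC I M).eqvGen_iff.1 (Quot.eqvGen_exact h)

/-- Galois types over `M` are determined by their small restrictions. -/
theorem GType.eq_of_restrict_eq {κ : Cardinal.{u}} (hκ : IsStronglyCompact κ)
    (hK : K.EssentiallyBelow κ) (hC : K.HasMonsterModel) {I M : Type u} [L.Structure M]
    (hM : K.Mem M) (p q : K.GType I M)
    (h : ∀ I₀ : Set I, #I₀ < κ → ∀ (M₀ : L.Substructure M) (h : K.Strong M M₀),
      #M₀ < κ + Order.succ K.LS →
        (p.restrictIndex I₀).restrict M₀ h = (q.restrictIndex I₀).restrict M₀ h) : p = q := by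
  obtain ⟨p, rfl⟩ := Quot.exists_rep p
  obtain ⟨q, rfl⟩ := Quot.exists_rep q
  let Λ : Type u := {X : Set I × L.Substructure M //
    #X.1 < κ ∧ K.Strong M X.2 ∧ #X.2 < κ + Order.succ K.LS}
  have hat : ∀ X : Λ, ((p.restrictIndex X.1.1).restrict X.1.2 X.2.2.1).AT
      ((q.restrictIndex X.1.1).restrict X.1.2 X.2.2.1) := fun X =>
    Pretype.at_of_mk_eq hC (h X.1.1 X.2.1 X.1.2 X.2.2.1 X.2.2.2)
  -- Restricting a pretype keeps its model, so `f X` and `g X` are defined on all of `p.N` and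
  -- `q.N`; only their agreement is limited to `X`.
  choose N str f g hf hg hfM hfa using hat
  obtain ⟨U, hU, hfine⟩ := hκ.exists_fine
    (fun X : Λ => Sum.elim X.1.1 (X.1.2 : Set M)) (β := I ⊕ M) (by
      intro A hA
      have hinl : #(Sum.inl ⁻¹' A : Set I) < κ :=
        (Cardinal.mk_preimage_of_injective _ _ Sum.inl_injective).trans_lt hA
      have hinr : #(Sum.inr ⁻¹' A : Set M) < κ :=
        (Cardinal.mk_preimage_of_injective _ _ Sum.inr_injective).trans_lt hA
      obtain ⟨S, hS, hAS, hc⟩ := K.LS_spec.2 M hM (Sum.inr ⁻¹' A)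
      refine ⟨⟨(Sum.inl ⁻¹' A, S), hinl, hS, hc.trans_lt ?_⟩, ?_⟩
      -- Source of the bound κ + LS(K)⁺: a strong submodel around fewer than κ elements has size at
      -- most their number plus LS(K).
      · exact Cardinal.add_lt_add hinr (Order.lt_succ _)
      · rintro (i | m) hx
        · exact hx
        · exact hAS hx)
  refine Quot.sound ?_
  -- The ultraproduct argument needs nonempty factors. If `p.N` is empty, so are `M` and `I`, and
  -- any single witness suffices.
  by_cases hne : Nonempty p.N
  · have (X : Λ) : Nonempty (N X) := hne.map (f X)
    have hcl := hK.closedUnderUltraproduct hκ.1 hU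
    refine ⟨_, inferInstance, Ultraproduct.lift U f, Ultraproduct.lift U g, hcl _ _ _ hf,
      hcl _ _ _ hg, fun m => ?_, fun i => ?_⟩
    · refine Ultraproduct.mk_eq_mk.2 ?_
      filter_upwards [hfine (Sum.inr m)] with X hX
      exact hfM X ⟨m, hX⟩
    · refine Ultraproduct.mk_eq_mk.2 ?_
      filter_upwards [hfine (Sum.inl i)] with X hX
      exact hfa X ⟨i, hX⟩
  · obtain ⟨X⟩ := U.neBot.nonempty
    exact ⟨N X, str X, f X, g X, hf X, hg X, fun m => absurd ⟨p.incl m⟩ hne,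
      fun i => absurd ⟨p.a i⟩ hne⟩

theorem GType.restrict_restrictIndex {I M : Type u} [L.Structure M] (p : K.GType I M) (I₀ : Set I)
    (M₀ : L.Substructure M) (h : K.Strong M M₀) :
    (p.restrictIndex I₀).restrict M₀ h = (p.restrict M₀ h).restrictIndex I₀ := by
  obtain ⟨p, rfl⟩ := Quot.exists_rep p
  rfl

end AEC

theorem mainTheorem1 {L : FirstOrder.Language.{u, u}} (K : AEC L) (κ : Cardinal.{u})
    (hκ : IsStronglyCompact κ) (hK : K.EssentiallyBelow κ) (hC : K.HasMonsterModel) :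
    (∀ (I M : Type u) [L.Structure M], K.Mem M → ∀ p q : K.GType I M,
      (∀ I₀ : Set I, #I₀ < κ → ∀ (M₀ : L.Substructure M) (h : K.Strong M M₀),
        #M₀ < κ + Order.succ K.LS →
          (p.restrictIndex I₀).restrict M₀ h = (q.restrictIndex I₀).restrict M₀ h) → p = q) ∧
    K.FullyTame (κ + Order.succ K.LS) ∧
    K.FullyTypeShort κ := by
  refine ⟨fun I M _ hM p q h => AEC.GType.eq_of_restrict_eq hκ hK hC hM p q h, ?_, ?_⟩
  · intro I μ _ M _ hM _ p q hpq
    by_contra! hcon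
    refine hpq (AEC.GType.eq_of_restrict_eq hκ hK hC hM p q fun I₀ _ M₀ h hM₀ => ?_)
    rw [AEC.GType.restrict_restrictIndex, AEC.GType.restrict_restrictIndex, hcon M₀ h hM₀]
  · intro μ ν _ M _ hM _ I _ p q hpq
    by_contra! hcon
    refine hpq (AEC.GType.eq_of_restrict_eq hκ hK hC hM p q fun I₀ hI₀ M₀ h _ => ?_)
    rw [hcon I₀ hI₀]
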